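/- For a finite sequence $\mathbf{s}=(s_1,\dots,s_r)$ of positive integers with $s_1>1$ let $$\zeta^\star(s_1,\dots,s_r)=\sum_{k_1\ge\cdots\ge k_r\ge 1}\frac{1}{k_1^{s_1}\cdots k_r^{s_r}}$$ be the multiple zeta star value, a convergent series over integer tuples, with $\zeta^\star(\emptyset)=1$ for the empty sequence ($r=0$). Let $\{3,1\}^d$ denote the sequence consisting of $d$ successive repetitions of $3,1$ (empty for $d=0$), and let $B_n$ denote the Bernoulli numbers, $\frac{t}{e^t-1}=\sum_{n\ge 0}B_n\frac{t^n}{n!}$. Then for every integer $d\ge 0$, $$\zeta^\star(\{3,1\}^d)=4\pi^{4d}\sum_{k=0}^{2d}(-1)^k\,(4^{k+1}-1)\,\frac{B_{2k+2}}{(2k+2)!}\,\frac{B_{4d-2k}}{(4d-2k)!},$$ $$\zeta^\star(\{3,1\}^d,2)=4\pi^{4d+2}\sum_{k=0}^{2d+1}(-1)^k\,(4^{k+1}-1)\,\frac{B_{2k+2}}{(2k+2)!}\,\frac{B_{4d+2-2k}}{(4d+2-2k)!}.$$ -/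

import Mathlib

/-- The weakly decreasing `r`-tuples `k₁ ≥ ⋯ ≥ k_r ≥ 1` of positive integers. -/
def StarIndex (r : ℕ) : Type :=
  {k : Fin r → ℕ // Antitone k ∧ ∀ i, 1 ≤ k i}

/-- The summand `1 / (k₁ ^ s₁ ⋯ k_r ^ s_r)` of the multiple zeta star series of `s`. -/
noncomputable def zetaStarTerm (s : List ℕ) (k : StarIndex s.length) : ℝ :=
  1 / ∏ i : Fin s.length, (k.1 i : ℝ) ^ s.get i

/-- The multiple zeta star value of the multi-index `s = (s₁, …, s_r)`; for the empty multi-index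
there is exactly one (empty) tuple, and the value is `1`. -/
noncomputable def zetaStar (s : List ℕ) : ℝ :=
  ∑' k : StarIndex s.length, zetaStarTerm s k

/-- The multi-index `{a₁, …, a_m}^d`: `d` successive repetitions of a finite sequence. -/
def repeatIndex (a : List ℕ) (d : ℕ) : List ℕ :=
  (List.replicate d a).flatten

/-!
A truncated star sum of `{3, 1}^d` or `{3, 1}^d, 2` is an average, with weights given by ratios of
central binomial coefficients, of the coefficients in `y` of the finite products
`∏ l < L, (1 + b l * y) / (1 - b l * y)`, where `b l = (-1) ^ l / (l + 1) ^ 2`: both sides satisfy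
the same recursion in the truncation. The averaging preserves limits, so the star values are the
coefficients of the infinite product. By Euler's sine product this infinite product equals
`tan (π z / 2) * coth (π z / 2)` at `y = z ^ 2`, and the Bernoulli expansions of `tan` and `coth`
turn its coefficients into the stated convolution.
-/

open Filter Finset Topology

namespace StarIndex

variable {r n : ℕ}

open Classical in
/-- The tuples with all entries at most `n`, the index set of a truncated star sum. -/
noncomputable def box (r n : ℕ) : Finset (StarIndex r) :=
  (Fintype.piFinset fun _ => Icc 1 n).subtype fun k => Antitone k ∧ ∀ i, 1 ≤ k i

theorem mem_box {k : StarIndex r} : k ∈ box r n ↔ ∀ i, k.1 i ≤ n :=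
  Finset.mem_subtype.trans <| Fintype.mem_piFinset.trans <|
    forall_congr' fun i => mem_Icc.trans (and_iff_right (k.2.2 i))

theorem card_box_zero (n : ℕ) : #(box 0 n) = 1 :=
  card_eq_one.2 ⟨⟨Fin.elim0, fun i => i.elim0, fun i => i.elim0⟩, eq_singleton_iff_unique_mem.2
    ⟨mem_box.2 fun i => i.elim0, fun _ _ => Subtype.ext (funext fun i => i.elim0)⟩⟩

theorem tendsto_box (r : ℕ) : Tendsto (box r) atTop atTop := by
  refine tendsto_atTop_finset_of_monotone (fun m n hmn k hk => ?_) fun k => ?_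
  · exact mem_box.2 fun i => (mem_box.1 hk i).trans hmn
  · exact ⟨∑ i, k.1 i, mem_box.2 fun i => single_le_sum_of_canonicallyOrdered (mem_univ i)⟩

theorem apply_le_apply_zero (k : StarIndex (r + 1)) (i : Fin (r + 1)) : k.1 i ≤ k.1 0 :=
  k.2.1 (Fin.zero_le i)

theorem mem_box_succ {k : StarIndex (r + 1)} : k ∈ box (r + 1) n ↔ k.1 0 ≤ n :=
  mem_box.trans ⟨fun h => h 0, fun h i => (k.apply_le_apply_zero i).trans h⟩

/-- The tuple `(k₂, …, k_r)` obtained from `(k₁, …, k_r)` by deleting the largest entry. -/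
def tail (k : StarIndex (r + 1)) : StarIndex r :=
  ⟨Fin.tail k.1, k.2.1.comp_monotone Fin.strictMono_succ.monotone, fun i => k.2.2 i.succ⟩

/-- The tuple `(n, k₁, …, k_r)`, where `n ≥ k₁`. -/
def cons (hn : 1 ≤ n) (k : StarIndex r) (hk : k ∈ box r n) : StarIndex (r + 1) :=
  ⟨Fin.cons n k.1, fun i j hij => by
    cases j using Fin.cases with
    | zero => rw [Fin.le_zero_iff.1 hij]
    | succ j =>
      cases i using Fin.cases with
      | zero => exact mem_box.1 hk j
      | succ i => exact k.2.1 (Fin.succ_le_succ_iff.1 hij),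
    Fin.cases hn k.2.2⟩

theorem tail_mem_box {k : StarIndex (r + 1)} (hk : k.1 0 ≤ n) : k.tail ∈ box r n :=
  mem_box.2 fun i => (k.apply_le_apply_zero i.succ).trans hk

theorem sum_box_succ {M : Type*} [AddCommMonoid M] (n : ℕ) {f : StarIndex (r + 1) → M}
    {g : StarIndex r → M} (hfg : ∀ k, k.1 0 = n + 1 → f k = g k.tail) :
    ∑ k ∈ box (r + 1) (n + 1), f k = ∑ k ∈ box (r + 1) n, f k + ∑ k ∈ box r (n + 1), g k := by
  have hlow : {k ∈ box (r + 1) (n + 1) | k.1 0 ≤ n} = box (r + 1) n := by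
    ext k
    simp only [mem_filter, mem_box_succ]
    omega
  have hhigh : ∀ k ∈ {k ∈ box (r + 1) (n + 1) | ¬ k.1 0 ≤ n}, k.1 0 = n + 1 := fun k hk => by
    simp only [mem_filter, mem_box_succ] at hk
    omega
  rw [← sum_filter_add_sum_filter_not _ fun k => k.1 0 ≤ n, hlow]
  congr 1
  refine sum_bij' (fun k _ => k.tail) (fun k hk => cons n.succ_pos k hk)
    (fun k hk => tail_mem_box (hhigh k hk).le) (fun k hk => ?_) (fun k hk => ?_) (fun k hk => ?_)
    fun k hk => hfg k (hhigh k hk)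
  · exact mem_filter.2 ⟨mem_box_succ.2 le_rfl, Nat.not_le.2 n.lt_succ_self⟩
  · refine Subtype.ext (funext (Fin.cases ?_ fun i => rfl))
    exact (hhigh k hk).symm
  · rfl

end StarIndex

theorem zetaStarTerm_nonneg (s : List ℕ) (k : StarIndex s.length) : 0 ≤ zetaStarTerm s k := by
  unfold zetaStarTerm
  positivity

theorem zetaStarTerm_nil (k : StarIndex ([] : List ℕ).length) : zetaStarTerm [] k = 1 := by
  simp [zetaStarTerm]

theorem zetaStarTerm_cons (a : ℕ) (s : List ℕ) (k : StarIndex (a :: s).length) :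
    zetaStarTerm (a :: s) k = zetaStarTerm s (StarIndex.tail k) / (k.1 0 : ℝ) ^ a := by
  have hprod := Fin.prod_univ_succ fun i : Fin (s.length + 1) => (k.1 i : ℝ) ^ (a :: s).get i
  rw [zetaStarTerm, zetaStarTerm, div_div, mul_comm]
  exact congrArg (1 / ·) hprod

/-- The truncated multiple zeta star sum over `n ≥ k₁ ≥ ⋯ ≥ k_r ≥ 1`. -/
noncomputable def truncStar (s : List ℕ) (n : ℕ) : ℝ :=
  ∑ k ∈ StarIndex.box s.length n, zetaStarTerm s k

theorem truncStar_nil (n : ℕ) : truncStar [] n = 1 := by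
  have hcard : #(StarIndex.box ([] : List ℕ).length n) = 1 := StarIndex.card_box_zero n
  rw [truncStar, sum_congr rfl fun k _ => zetaStarTerm_nil k, sum_const, hcard, one_smul]

theorem truncStar_cons_zero (a : ℕ) (s : List ℕ) : truncStar (a :: s) 0 = 0 :=
  sum_eq_zero fun k hk =>
    absurd (StarIndex.mem_box_succ.1 hk) (Nat.not_le.2 (k.2.2 0))

theorem truncStar_cons_succ (a : ℕ) (s : List ℕ) (n : ℕ) :
    truncStar (a :: s) (n + 1) =
      truncStar (a :: s) n + truncStar s (n + 1) / ((n : ℝ) + 1) ^ a := by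
  have hterm : ∀ k : StarIndex (s.length + 1), k.1 0 = n + 1 →
      zetaStarTerm (a :: s) k = zetaStarTerm s k.tail / ((n : ℝ) + 1) ^ a := fun k hk => by
    rw [zetaStarTerm_cons, hk, Nat.cast_add_one]
  rw [truncStar, truncStar, truncStar, sum_div]
  exact StarIndex.sum_box_succ n hterm

theorem hasSum_of_tendsto_sum_of_nonneg {ι : Type*} {f : ι → ℝ} (hf : ∀ i, 0 ≤ f i)
    {t : ℕ → Finset ι} (ht : Tendsto t atTop atTop) {L : ℝ}
    (h : Tendsto (fun n => ∑ i ∈ t n, f i) atTop (𝓝 L)) : HasSum f L := by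
  have hmono : Monotone fun u : Finset ι => ∑ i ∈ u, f i :=
    fun u v huv => sum_le_sum_of_subset_of_nonneg huv fun i _ _ => hf i
  rw [HasSum, SummationFilter.unconditional_filter]
  exact (tendsto_iff_tendsto_subseq_of_monotone hmono ht).2 h

theorem hasSum_zetaStarTerm {s : List ℕ} {L : ℝ} (h : Tendsto (truncStar s) atTop (𝓝 L)) :
    HasSum (zetaStarTerm s) L :=
  hasSum_of_tendsto_sum_of_nonneg (zetaStarTerm_nonneg s) (StarIndex.tendsto_box _) h

section CentralTransform

variable {K : Type*} [Field K]

variable (K) in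
/-- The ratio `(2n choose n + l) / (2n choose n) = n! ^ 2 / ((n - l)! * (n + l)!)` of a binomial
coefficient to the central one. -/
def centralRatio (n l : ℕ) : K :=
  ((2 * n).choose (n + l) : K) / n.centralBinom

theorem centralRatio_eq_zero {n l : ℕ} (h : n < l) : centralRatio K n l = 0 := by
  rw [centralRatio, Nat.choose_eq_zero_of_lt (by omega), Nat.cast_zero, zero_div]

theorem centralRatio_succ (n l : ℕ) :
    ((n : K) + l + 1) * centralRatio K n (l + 1) = (n - l) * centralRatio K n l := by
  rcases le_or_gt l n with hl | hl
  · have h := Nat.choose_succ_right_eq (2 * n) (n + l)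
    rw [show 2 * n - (n + l) = n - l by omega] at h
    have h' := congrArg (Nat.cast : ℕ → K) h
    push_cast [hl] at h'
    rw [centralRatio, centralRatio, ← add_assoc, mul_div_assoc', mul_div_assoc', mul_comm, h',
      mul_comm]
  · rw [centralRatio_eq_zero hl, centralRatio_eq_zero (Nat.lt_succ_of_lt hl), mul_zero, mul_zero]

/-- The sum `∑ c_l * (2n choose n + l) / (2n choose n)` over `1 ≤ l ≤ n`, where the sequence
`c₁, c₂, …` is indexed from zero. -/
def centralSum (c : ℕ → K) (n : ℕ) : K :=
  ∑ l ∈ range n, c l * centralRatio K n (l + 1)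

/-- The weighted mean of `q 0, …, q n` obtained from the increments of `q` by summation by parts
against the central binomial ratios. -/
def centralTransform (q : ℕ → K) (n : ℕ) : K :=
  q 0 + centralSum (fun l => q (l + 1) - q l) n

/-- The alternating companion of `centralTransform`, weighting the increments of `q` by
`1, -2, 3, -4, …`. -/
def altCentralTransform (q : ℕ → K) (n : ℕ) : K :=
  centralSum (fun l => (-1) ^ l * ((l : K) + 1) * (q (l + 1) - q l)) n

variable [CharZero K]

theorem centralBinom_cast_ne_zero (n : ℕ) : (n.centralBinom : K) ≠ 0 :=
  Nat.cast_ne_zero.2 n.centralBinom_ne_zero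

theorem centralRatio_zero (n : ℕ) : centralRatio K n 0 = 1 := by
  rw [centralRatio, add_zero, ← Nat.centralBinom_eq_two_mul_choose,
    div_self (centralBinom_cast_ne_zero n)]

theorem centralRatio_succ_left (n l : ℕ) :
    (((n : K) + 1) ^ 2 - l ^ 2) * centralRatio K (n + 1) l =
      ((n : K) + 1) ^ 2 * centralRatio K n l := by
  induction l with
  | zero => simp only [centralRatio_zero, Nat.cast_zero]; ring
  | succ l ih =>
    have h₁ := centralRatio_succ (K := K) n l
    have h₂ := centralRatio_succ (K := K) (n + 1) l
    have hne : (n : K) + l + 1 ≠ 0 := by exact_mod_cast (n + l).succ_ne_zero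
    push_cast at h₂ ⊢
    refine mul_left_cancel₀ hne ?_
    linear_combination (n - l : K) * ih + ((n : K) + l + 1) * (n - l) * h₂ - (n + 1 : K) ^ 2 * h₁

theorem centralSum_succ_sub (c : ℕ → K) (n : ℕ) :
    centralSum c (n + 1) - centralSum c n =
      centralSum (fun l => ((l : K) + 1) ^ 2 * c l) (n + 1) / ((n : K) + 1) ^ 2 := by
  have hn : ((n : K) + 1) ^ 2 ≠ 0 := pow_ne_zero 2 n.cast_add_one_ne_zero
  have hext : centralSum c n = ∑ l ∈ range (n + 1), c l * centralRatio K n (l + 1) := by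
    rw [centralSum, sum_range_succ, centralRatio_eq_zero n.lt_succ_self, mul_zero, add_zero]
  rw [eq_div_iff hn, hext, centralSum, centralSum, ← sum_sub_distrib, sum_mul]
  refine sum_congr rfl fun l _ => ?_
  have h := centralRatio_succ_left (K := K) n (l + 1)
  push_cast at h
  linear_combination c l * h

theorem centralSum_index_mul_add (q : ℕ → K) (n : ℕ) :
    centralSum (fun l => ((l : K) + 1) * (q (l + 1) + q l)) n = n * centralTransform q n := by
  have htel : ∀ l ∈ range n,
      ((l : K) + 1) * (q (l + 1) + q l) * centralRatio K n (l + 1) -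
        n * ((q (l + 1) - q l) * centralRatio K n (l + 1)) =
      ((n - l) * centralRatio K n l * q l) -
        (n - (l + 1 : ℕ)) * centralRatio K n (l + 1) * q (l + 1) := fun l _ => by
    push_cast
    linear_combination q l * centralRatio_succ (K := K) n l
  rw [centralTransform, mul_add, ← sub_eq_iff_eq_add, centralSum, centralSum, mul_sum,
    ← sum_sub_distrib, sum_congr rfl htel,
    sum_range_sub' fun l => ((n : K) - l) * centralRatio K n l * q l]
  simp only [centralRatio_zero, Nat.cast_zero, sub_self]
  ring

theorem centralSum_alternating_add (q : ℕ → K) (n : ℕ) :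
    n * centralSum (fun l => (-1) ^ l * (q (l + 1) + q l)) n =
      n * q 0 + altCentralTransform q n := by
  have h := centralSum_index_mul_add (fun l => (-1) ^ l * q l) n
  rw [centralTransform, mul_add, pow_zero, one_mul] at h
  have hadd :
      centralSum (fun l => ((l : K) + 1) * ((-1) ^ (l + 1) * q (l + 1) + (-1) ^ l * q l)) n =
        -altCentralTransform q n := by
    rw [altCentralTransform, centralSum, centralSum, ← sum_neg_distrib]
    exact sum_congr rfl fun l _ => by ring
  have hsub : centralSum (fun l => (-1) ^ (l + 1) * q (l + 1) - (-1) ^ l * q l) n =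
      -centralSum (fun l => (-1) ^ l * (q (l + 1) + q l)) n := by
    rw [centralSum, centralSum, ← sum_neg_distrib]
    exact sum_congr rfl fun l _ => by ring
  rw [hadd, hsub] at h
  linear_combination h

end CentralTransform

section CentralRegularity

variable {𝕜 : Type*} [RCLike 𝕜]

theorem norm_centralRatio_le_one (n l : ℕ) : ‖centralRatio 𝕜 n l‖ ≤ 1 := by
  rw [centralRatio, norm_div, RCLike.norm_natCast, RCLike.norm_natCast]
  refine div_le_one_of_le₀ ?_ (Nat.cast_nonneg _)
  exact_mod_cast Nat.choose_le_centralBinom _ _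

theorem tendsto_centralRatio (l : ℕ) :
    Tendsto (fun n => centralRatio 𝕜 n l) atTop (𝓝 1) := by
  induction l with
  | zero => simp only [centralRatio_zero, tendsto_const_nhds]
  | succ l ih =>
    have hquot : Tendsto (fun n : ℕ => ((n : 𝕜) - l) / (n + l + 1)) atTop (𝓝 1) := by
      have h := tendsto_add_mul_div_add_mul_atTop_nhds (-(l : 𝕜)) (l + 1) 1 one_ne_zero
      rw [div_one] at h
      exact h.congr fun n => by ring
    have hmul := hquot.mul ih
    rw [one_mul] at hmul
    refine hmul.congr fun n => ?_
    have hne : (n : 𝕜) + l + 1 ≠ 0 := by exact_mod_cast (n + l).succ_ne_zero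
    rw [div_mul_eq_mul_div, div_eq_iff hne, ← centralRatio_succ, mul_comm]

theorem tendsto_centralSum {c : ℕ → 𝕜} (hc : Summable fun l => ‖c l‖) :
    Tendsto (centralSum c) atTop (𝓝 (∑' l, c l)) := by
  have htsum : centralSum c = fun n => ∑' l, c l * centralRatio 𝕜 n (l + 1) := by
    funext n
    refine (tsum_eq_sum fun l hl => ?_).symm
    rw [centralRatio_eq_zero (Nat.lt_succ_of_le (not_lt.1 (mem_range.not.1 hl))), mul_zero]
  rw [htsum]
  refine tendsto_tsum_of_dominated_convergence hc (fun l => ?_) (.of_forall fun n l => ?_)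
  · simpa only [mul_one] using (tendsto_centralRatio (l + 1)).const_mul (c l)
  · rw [norm_mul]
    exact mul_le_of_le_one_right (norm_nonneg _) (norm_centralRatio_le_one n (l + 1))

theorem tendsto_centralTransform {q : ℕ → 𝕜} {a : 𝕜} (hq : Tendsto q atTop (𝓝 a))
    (hsum : Summable fun l => ‖q (l + 1) - q l‖) :
    Tendsto (centralTransform q) atTop (𝓝 a) := by
  have htel : HasSum (fun l => q (l + 1) - q l) (a - q 0) := by
    refine (hsum.of_norm.hasSum_iff_tendsto_nat).2 ?_
    simpa only [sum_range_sub] using hq.sub_const (q 0)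
  have h := (tendsto_centralSum hsum).const_add (q 0)
  rwa [htel.tsum_eq, add_sub_cancel] at h

end CentralRegularity

section ProdRatio

variable {R : Type*} [CommRing R]

/-- The coefficient of `y ^ m` in `∏ l < L, (1 + b l * y) / (1 - b l * y)`. -/
def prodRatioCoeff (b : ℕ → R) : ℕ → ℕ → R
  | 0, _ => 1
  | m + 1, L => ∑ l ∈ range L, b l * (prodRatioCoeff b m (l + 1) + prodRatioCoeff b m l)

theorem prodRatioCoeff_zero (b : ℕ → R) (L : ℕ) : prodRatioCoeff b 0 L = 1 := rfl

theorem prodRatioCoeff_succ_sub (b : ℕ → R) (m L : ℕ) :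
    prodRatioCoeff b (m + 1) (L + 1) - prodRatioCoeff b (m + 1) L =
      b L * (prodRatioCoeff b m (L + 1) + prodRatioCoeff b m L) := by
  rw [prodRatioCoeff, prodRatioCoeff, sum_range_succ_sub_sum]

theorem map_prodRatioCoeff {S : Type*} [CommRing S] (f : R →+* S) (b : ℕ → R)
    (m L : ℕ) : f (prodRatioCoeff b m L) = prodRatioCoeff (fun l => f (b l)) m L := by
  induction m generalizing L with
  | zero => exact map_one f
  | succ m ih => simp only [prodRatioCoeff, map_sum, map_mul, map_add, ih]

variable {𝕜 : Type*} [NormedField 𝕜] {b : ℕ → 𝕜}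

/-- The coefficient of `y ^ m` in the infinite product `∏ l, (1 + b l * y) / (1 - b l * y)`. -/
noncomputable def prodRatioLimit (b : ℕ → 𝕜) : ℕ → 𝕜
  | 0 => 1
  | m + 1 => ∑' l, b l * (prodRatioCoeff b m (l + 1) + prodRatioCoeff b m l)

theorem ofReal_prodRatioLimit (b : ℕ → ℝ) (m : ℕ) :
    ((prodRatioLimit b m : ℝ) : ℂ) = prodRatioLimit (fun l => (b l : ℂ)) m := by
  cases m with
  | zero => exact Complex.ofReal_one
  | succ m =>
    have hcoeff := map_prodRatioCoeff Complex.ofRealHom b m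
    simp only [Complex.ofRealHom_eq_coe] at hcoeff
    simp only [prodRatioLimit, Complex.ofReal_tsum, Complex.ofReal_mul, Complex.ofReal_add, hcoeff]

theorem norm_mul_add_le_of_norm_le {x y z : 𝕜} {C : ℝ} (hy : ‖y‖ ≤ C) (hz : ‖z‖ ≤ C) :
    ‖x * (y + z)‖ ≤ ‖x‖ * (2 * C) := by
  rw [norm_mul, two_mul]
  gcongr
  exact norm_add_le_of_le hy hz

theorem norm_prodRatioCoeff_le (hb : Summable fun l => ‖b l‖) (m L : ℕ) :
    ‖prodRatioCoeff b m L‖ ≤ (2 * ∑' l, ‖b l‖) ^ m := by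
  induction m generalizing L with
  | zero => rw [prodRatioCoeff, norm_one, pow_zero]
  | succ m ih =>
    calc ‖prodRatioCoeff b (m + 1) L‖
        ≤ ∑ l ∈ range L, ‖b l‖ * (2 * (2 * ∑' l, ‖b l‖) ^ m) :=
          norm_sum_le_of_le _ fun l _ => norm_mul_add_le_of_norm_le (ih _) (ih _)
      _ = (∑ l ∈ range L, ‖b l‖) * (2 * (2 * ∑' l, ‖b l‖) ^ m) := (sum_mul _ _ _).symm
      _ ≤ (∑' l, ‖b l‖) * (2 * (2 * ∑' l, ‖b l‖) ^ m) := by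
          gcongr
          exact hb.sum_le_tsum _ fun l _ => norm_nonneg _
      _ = (2 * ∑' l, ‖b l‖) ^ (m + 1) := by ring

theorem summable_norm_prodRatioCoeff_succ_sub (hb : Summable fun l => ‖b l‖) (m : ℕ) :
    Summable fun l => ‖prodRatioCoeff b m (l + 1) - prodRatioCoeff b m l‖ := by
  cases m with
  | zero => simp only [prodRatioCoeff, sub_self, norm_zero, summable_zero]
  | succ m =>
    simp only [prodRatioCoeff_succ_sub]
    exact .of_nonneg_of_le (fun l => norm_nonneg _)
      (fun l => norm_mul_add_le_of_norm_le (norm_prodRatioCoeff_le hb m (l + 1))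
        (norm_prodRatioCoeff_le hb m l)) (hb.mul_right _)

theorem norm_prodRatioCoeff_mul_pow_le (hb : Summable fun l => ‖b l‖) (y : 𝕜) (m L : ℕ) :
    ‖prodRatioCoeff b m L * y ^ m‖ ≤ (2 * (∑' l, ‖b l‖) * ‖y‖) ^ m := by
  rw [norm_mul, norm_pow, mul_pow _ ‖y‖]
  gcongr
  exact norm_prodRatioCoeff_le hb m L

theorem summable_prodRatio_bound {y : 𝕜} (hy : 2 * (∑' l, ‖b l‖) * ‖y‖ < 1) :
    Summable fun m : ℕ => (2 * (∑' l, ‖b l‖) * ‖y‖) ^ m :=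
  summable_geometric_of_lt_one
    (mul_nonneg (mul_nonneg zero_le_two (tsum_nonneg fun _ => norm_nonneg _)) (norm_nonneg _)) hy

variable [CompleteSpace 𝕜]

theorem multipliable_one_sub_of_summable_norm {f : ℕ → 𝕜} (hf : Summable fun l => ‖f l‖) :
    Multipliable fun l => 1 - f l := by
  simp only [sub_eq_add_neg]
  exact multipliable_one_add_of_summable (by simpa only [norm_neg] using hf)

theorem tendsto_prodRatioCoeff (hb : Summable fun l => ‖b l‖) (m : ℕ) :
    Tendsto (prodRatioCoeff b m) atTop (𝓝 (prodRatioLimit b m)) := by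
  cases m with
  | zero => exact tendsto_const_nhds
  | succ m =>
    have h := summable_norm_prodRatioCoeff_succ_sub hb (m + 1)
    simp only [prodRatioCoeff_succ_sub] at h
    exact h.of_norm.hasSum.tendsto_sum_nat

theorem norm_prodRatioLimit_mul_pow_le (hb : Summable fun l => ‖b l‖) (y : 𝕜) (m : ℕ) :
    ‖prodRatioLimit b m * y ^ m‖ ≤ (2 * (∑' l, ‖b l‖) * ‖y‖) ^ m :=
  le_of_tendsto ((tendsto_prodRatioCoeff hb m).mul_const _).norm
    (.of_forall fun L => norm_prodRatioCoeff_mul_pow_le hb y m L)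

section GeneratingFunction

variable {y : 𝕜}

theorem summable_prodRatioCoeff_mul_pow (hb : Summable fun l => ‖b l‖)
    (hy : 2 * (∑' l, ‖b l‖) * ‖y‖ < 1) (L : ℕ) : Summable fun m => prodRatioCoeff b m L * y ^ m :=
  .of_norm_bounded (summable_prodRatio_bound hy)
    fun m => norm_prodRatioCoeff_mul_pow_le hb y m L

theorem summable_prodRatioLimit_mul_pow (hb : Summable fun l => ‖b l‖)
    (hy : 2 * (∑' l, ‖b l‖) * ‖y‖ < 1) : Summable fun m => prodRatioLimit b m * y ^ m :=
  .of_norm_bounded (summable_prodRatio_bound hy) (norm_prodRatioLimit_mul_pow_le hb y)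

theorem tsum_prodRatioCoeff_succ_sub (hb : Summable fun l => ‖b l‖)
    (hy : 2 * (∑' l, ‖b l‖) * ‖y‖ < 1) (L : ℕ) :
    (∑' m, prodRatioCoeff b m (L + 1) * y ^ m) - ∑' m, prodRatioCoeff b m L * y ^ m =
      b L * y * ((∑' m, prodRatioCoeff b m (L + 1) * y ^ m) +
        ∑' m, prodRatioCoeff b m L * y ^ m) := by
  have hsum := summable_prodRatioCoeff_mul_pow hb hy
  have hshift : ∀ L, Summable fun m => prodRatioCoeff b (m + 1) L * y ^ (m + 1) := fun L =>
    (hsum L).comp_injective (add_left_injective 1)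
  calc (∑' m, prodRatioCoeff b m (L + 1) * y ^ m) - ∑' m, prodRatioCoeff b m L * y ^ m
      = (∑' m, prodRatioCoeff b (m + 1) (L + 1) * y ^ (m + 1)) -
          ∑' m, prodRatioCoeff b (m + 1) L * y ^ (m + 1) := by
        rw [(hsum (L + 1)).tsum_eq_zero_add, (hsum L).tsum_eq_zero_add,
          prodRatioCoeff_zero, prodRatioCoeff_zero, add_sub_add_left_eq_sub]
    _ = ∑' m, b L * y * (prodRatioCoeff b m (L + 1) * y ^ m + prodRatioCoeff b m L * y ^ m) := by
        rw [← (hshift (L + 1)).tsum_sub (hshift L)]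
        refine tsum_congr fun m => ?_
        rw [← sub_mul, prodRatioCoeff_succ_sub]
        ring
    _ = b L * y * ((∑' m, prodRatioCoeff b m (L + 1) * y ^ m) +
          ∑' m, prodRatioCoeff b m L * y ^ m) := by
        rw [tsum_mul_left, (hsum (L + 1)).tsum_add (hsum L)]

theorem tsum_prodRatioCoeff_mul_prod (hb : Summable fun l => ‖b l‖)
    (hy : 2 * (∑' l, ‖b l‖) * ‖y‖ < 1) (L : ℕ) :
    (∑' m, prodRatioCoeff b m L * y ^ m) * ∏ l ∈ range L, (1 - b l * y) =
      ∏ l ∈ range L, (1 + b l * y) := by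
  induction L with
  | zero =>
    rw [(summable_prodRatioCoeff_mul_pow hb hy 0).tsum_eq_zero_add]
    simp [prodRatioCoeff]
  | succ L ih =>
    rw [prod_range_succ, prod_range_succ, ← ih]
    linear_combination (∏ l ∈ range L, (1 - b l * y)) * tsum_prodRatioCoeff_succ_sub hb hy L

theorem tsum_prodRatioLimit_mul_tprod (hb : Summable fun l => ‖b l‖)
    (hy : 2 * (∑' l, ‖b l‖) * ‖y‖ < 1) :
    (∑' m, prodRatioLimit b m * y ^ m) * ∏' l, (1 - b l * y) = ∏' l, (1 + b l * y) := by
  have hsum : Tendsto (fun L => ∑' m, prodRatioCoeff b m L * y ^ m) atTop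
      (𝓝 (∑' m, prodRatioLimit b m * y ^ m)) :=
    tendsto_tsum_of_dominated_convergence (summable_prodRatio_bound hy)
      (fun m => (tendsto_prodRatioCoeff hb m).mul_const _)
      (.of_forall fun L m => norm_prodRatioCoeff_mul_pow_le hb y m L)
  have hby : Summable fun l => ‖b l * y‖ := by
    simpa only [norm_mul] using hb.mul_right ‖y‖
  have hnum := (multipliable_one_add_of_summable hby).hasProd.tendsto_prod_nat
  have hden := (multipliable_one_sub_of_summable_norm hby).hasProd.tendsto_prod_nat
  exact tendsto_nhds_unique (hsum.mul hden)
    (hnum.congr fun L => (tsum_prodRatioCoeff_mul_prod hb hy L).symm)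

end GeneratingFunction

end ProdRatio

section ThreeOne

/-- The alternating sequence `1, -1/4, 1/9, -1/16, …`. -/
noncomputable def altInvSq (l : ℕ) : ℝ :=
  (-1) ^ l / ((l : ℝ) + 1) ^ 2

theorem add_one_sq_mul_altInvSq (l : ℕ) : ((l : ℝ) + 1) ^ 2 * altInvSq l = (-1) ^ l :=
  mul_div_cancel₀ _ (pow_ne_zero 2 l.cast_add_one_ne_zero)

theorem summable_norm_altInvSq : Summable fun l => ‖altInvSq l‖ := by
  have h := (summable_nat_add_iff 1).2 (Real.summable_one_div_nat_pow.2 one_lt_two)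
  refine h.congr fun l => ?_
  rw [altInvSq, norm_div, norm_pow, norm_pow, norm_neg, norm_one, one_pow, Nat.cast_add_one,
    Real.norm_of_nonneg l.cast_add_one_pos.le]

/-- The multi-indices `∅, (2), (3, 1), (3, 1, 2), (3, 1, 3, 1), …` of weight `2 * m`. -/
def threeOneIndex : ℕ → List ℕ
  | 0 => []
  | 1 => [2]
  | m + 2 => 3 :: 1 :: threeOneIndex m

theorem threeOneIndex_two_mul (d : ℕ) : threeOneIndex (2 * d) = repeatIndex [3, 1] d := by
  induction d with
  | zero => rfl
  | succ d ih =>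
    rw [Nat.mul_succ, threeOneIndex, ih]
    rfl

theorem threeOneIndex_two_mul_add_one (d : ℕ) :
    threeOneIndex (2 * d + 1) = repeatIndex [3, 1] d ++ [2] := by
  induction d with
  | zero => rfl
  | succ d ih =>
    rw [Nat.mul_succ, add_right_comm, threeOneIndex, ih]
    rfl

theorem centralTransform_prodRatioCoeff_succ (m n : ℕ) :
    centralTransform (prodRatioCoeff altInvSq (m + 1)) (n + 1) =
      centralTransform (prodRatioCoeff altInvSq (m + 1)) n +
        (prodRatioCoeff altInvSq m 0 +
          altCentralTransform (prodRatioCoeff altInvSq m) (n + 1) / ((n : ℝ) + 1)) /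
            ((n : ℝ) + 1) ^ 2 := by
  have hn : (n : ℝ) + 1 ≠ 0 := n.cast_add_one_ne_zero
  have halt := centralSum_alternating_add (prodRatioCoeff altInvSq m) (n + 1)
  rw [Nat.cast_add_one, mul_comm, ← eq_div_iff hn, add_div, mul_div_cancel_left₀ _ hn] at halt
  rw [← sub_eq_iff_eq_add', centralTransform, centralTransform, add_sub_add_left_eq_sub,
    centralSum_succ_sub, ← halt]
  simp only [prodRatioCoeff_succ_sub, ← mul_assoc, add_one_sq_mul_altInvSq]

theorem altCentralTransform_prodRatioCoeff_succ (m n : ℕ) :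
    altCentralTransform (prodRatioCoeff altInvSq (m + 1)) (n + 1) =
      altCentralTransform (prodRatioCoeff altInvSq (m + 1)) n +
        centralTransform (prodRatioCoeff altInvSq m) (n + 1) / ((n : ℝ) + 1) := by
  have hn : (n : ℝ) + 1 ≠ 0 := n.cast_add_one_ne_zero
  have hcoeff : ∀ l : ℕ, ((l : ℝ) + 1) ^ 2 * ((-1) ^ l * ((l : ℝ) + 1) *
      (prodRatioCoeff altInvSq (m + 1) (l + 1) - prodRatioCoeff altInvSq (m + 1) l)) =
      ((l : ℝ) + 1) * (prodRatioCoeff altInvSq m (l + 1) + prodRatioCoeff altInvSq m l) :=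
    fun l => by
      have hsign : (-1 : ℝ) ^ l * (-1) ^ l = 1 := by rw [← mul_pow, neg_one_mul, neg_neg, one_pow]
      have hb := add_one_sq_mul_altInvSq l
      rw [prodRatioCoeff_succ_sub]
      linear_combination ((l : ℝ) + 1) *
        (prodRatioCoeff altInvSq m (l + 1) + prodRatioCoeff altInvSq m l) *
          ((-1) ^ l * hb + hsign)
  rw [← sub_eq_iff_eq_add', altCentralTransform, altCentralTransform, centralSum_succ_sub]
  simp only [hcoeff]
  rw [centralSum_index_mul_add, Nat.cast_add_one, sq, mul_div_mul_left _ _ hn]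

theorem truncStar_threeOneIndex (m n : ℕ) :
    truncStar (threeOneIndex m) n = centralTransform (prodRatioCoeff altInvSq m) n := by
  induction m using Nat.twoStepInduction generalizing n with
  | zero => simp [threeOneIndex, truncStar_nil, centralTransform, centralSum, prodRatioCoeff]
  | one =>
    induction n with
    | zero =>
      simp [threeOneIndex, truncStar_cons_zero, centralTransform, centralSum, prodRatioCoeff]
    | succ n ih =>
      rw [centralTransform_prodRatioCoeff_succ, ← ih, threeOneIndex, truncStar_cons_succ,
        truncStar_nil]
      simp [prodRatioCoeff_zero, altCentralTransform, centralSum]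
  | more m ih _ =>
    have hone : ∀ n, truncStar (1 :: threeOneIndex m) n =
        altCentralTransform (prodRatioCoeff altInvSq (m + 1)) n := fun n => by
      induction n with
      | zero => rw [truncStar_cons_zero, altCentralTransform, centralSum, sum_range_zero]
      | succ n ihn =>
        rw [altCentralTransform_prodRatioCoeff_succ, truncStar_cons_succ, ihn, ih, pow_one]
    induction n with
    | zero =>
      simp [threeOneIndex, truncStar_cons_zero, centralTransform, centralSum, prodRatioCoeff]
    | succ n ihn =>
      rw [centralTransform_prodRatioCoeff_succ, ← ihn, threeOneIndex, truncStar_cons_succ, hone,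
        prodRatioCoeff, sum_range_zero, zero_add, div_div, ← pow_succ']

theorem hasSum_zetaStarTerm_threeOneIndex (m : ℕ) :
    HasSum (zetaStarTerm (threeOneIndex m)) (prodRatioLimit altInvSq m) :=
  hasSum_zetaStarTerm <| (tendsto_centralTransform
    (tendsto_prodRatioCoeff summable_norm_altInvSq m)
    (summable_norm_prodRatioCoeff_succ_sub summable_norm_altInvSq m)).congr fun n =>
      (truncStar_threeOneIndex m n).symm

end ThreeOne

section EulerProduct

/-- Euler's infinite product `∏ j ≥ 1, (1 - w / j ^ 2)`, with values `sin (π z) / (π z)` at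
`w = z ^ 2` and `sinh (π z) / (π z)` at `w = -z ^ 2`. -/
noncomputable def eulerSineProd (w : ℂ) : ℂ :=
  ∏' j : ℕ, (1 - w / ((j : ℂ) + 1) ^ 2)

theorem summable_norm_div_add_one_sq (w : ℂ) : Summable fun j : ℕ => ‖w / ((j : ℂ) + 1) ^ 2‖ := by
  have h := (summable_nat_add_iff 1).2 (Real.summable_one_div_nat_pow.2 one_lt_two)
  refine (h.mul_left ‖w‖).congr fun j => ?_
  rw [norm_div, norm_pow, ← Nat.cast_add_one, Complex.norm_natCast, mul_one_div]

theorem pi_mul_mul_eulerSineProd_sq (z : ℂ) :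
    Real.pi * z * eulerSineProd (z ^ 2) = Complex.sin (Real.pi * z) :=
  tendsto_nhds_unique
    ((multipliable_one_sub_of_summable_norm
      (summable_norm_div_add_one_sq (z ^ 2))).hasProd.tendsto_prod_nat.const_mul _)
    (Complex.tendsto_euler_sin_prod z)

theorem pi_mul_mul_eulerSineProd_neg_sq (z : ℂ) :
    Real.pi * z * eulerSineProd (-z ^ 2) = Complex.sinh (Real.pi * z) := by
  have h := pi_mul_mul_eulerSineProd_sq (z * Complex.I)
  rw [mul_pow, Complex.I_sq, mul_neg_one, ← mul_assoc, Complex.sin_mul_I] at h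
  exact mul_right_cancel₀ Complex.I_ne_zero (by rw [← h]; ring)

theorem tprod_even_mul_eulerSineProd {f : ℕ → ℂ} (hf : Summable fun l => ‖f l‖) {w : ℂ}
    (hodd : ∀ k, f (2 * k + 1) = w / ((k : ℂ) + 1) ^ 2) :
    (∏' k, (1 - f (2 * k))) * eulerSineProd w = ∏' l, (1 - f l) := by
  have heven : Function.Injective fun k : ℕ => 2 * k := mul_right_injective₀ two_ne_zero
  have hoddsucc : Function.Injective fun k : ℕ => 2 * k + 1 := fun _ _ h => by simpa using h
  have h := tprod_even_mul_odd (f := fun l => 1 - f l)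
    (multipliable_one_sub_of_summable_norm (hf.comp_injective heven))
    (multipliable_one_sub_of_summable_norm (hf.comp_injective hoddsucc))
  simpa only [eulerSineProd, hodd] using h

theorem tprod_one_sub_altInvSq_mul_mul_eulerSineProd (w : ℂ) :
    (∏' l, (1 - altInvSq l * w)) * eulerSineProd (w / 4) =
      eulerSineProd w * eulerSineProd (-w / 4) := by
  have hsum : Summable fun l => ‖(altInvSq l : ℂ) * w‖ := by
    simpa only [norm_mul, Complex.norm_real] using summable_norm_altInvSq.mul_right ‖w‖
  have hsplit := tprod_even_mul_eulerSineProd (summable_norm_div_add_one_sq w) (w := w / 4)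
    fun k => by rw [div_div]; push_cast; ring
  have haltsplit := tprod_even_mul_eulerSineProd hsum (w := -w / 4) fun k => by
    rw [altInvSq, Odd.neg_one_pow ⟨k, rfl⟩, div_div]
    push_cast
    ring
  have heven : ∀ k : ℕ, (altInvSq (2 * k) : ℂ) * w = w / (((2 * k : ℕ) : ℂ) + 1) ^ 2 := fun k => by
    rw [altInvSq, Even.neg_one_pow ⟨k, two_mul k⟩]
    push_cast
    ring
  simp only [heven] at haltsplit
  rw [← haltsplit, eulerSineProd.eq_1 w, ← hsplit]
  ring

theorem tsum_prodRatioLimit_altInvSq_mul_eulerSineProd {w : ℂ}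
    (hw : 2 * (∑' l, ‖altInvSq l‖) * ‖w‖ < 1) :
    (∑' m, ((prodRatioLimit altInvSq m : ℝ) : ℂ) * w ^ m) *
        (eulerSineProd w * eulerSineProd (-w / 4) ^ 2) =
      eulerSineProd (-w) * eulerSineProd (w / 4) ^ 2 := by
  have hratio := tsum_prodRatioLimit_mul_tprod (b := fun l => (altInvSq l : ℂ))
    (by simpa only [Complex.norm_real] using summable_norm_altInvSq)
    (by simpa only [Complex.norm_real] using hw)
  have hden := tprod_one_sub_altInvSq_mul_mul_eulerSineProd w
  have hnum := tprod_one_sub_altInvSq_mul_mul_eulerSineProd (-w)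
  simp only [mul_neg, sub_neg_eq_add, neg_neg] at hnum
  simp only [← ofReal_prodRatioLimit] at hratio
  linear_combination (eulerSineProd (w / 4) * eulerSineProd (-w / 4)) * hratio +
    eulerSineProd (w / 4) * hnum -
    (∑' m, ((prodRatioLimit altInvSq m : ℝ) : ℂ) * w ^ m) * eulerSineProd (-w / 4) * hden

theorem tsum_prodRatioLimit_altInvSq_mul_sin {z : ℂ}
    (hz : 2 * (∑' l, ‖altInvSq l‖) * ‖z ^ 2‖ < 1) :
    (∑' m, ((prodRatioLimit altInvSq m : ℝ) : ℂ) * (z ^ 2) ^ m) *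
        (Complex.sin (Real.pi * z) * Complex.sinh (Real.pi * (z / 2)) ^ 2) =
      Complex.sinh (Real.pi * z) * Complex.sin (Real.pi * (z / 2)) ^ 2 := by
  have hhalf : (z / 2) ^ 2 = z ^ 2 / 4 := by ring
  rw [← pi_mul_mul_eulerSineProd_sq, ← pi_mul_mul_eulerSineProd_sq,
    ← pi_mul_mul_eulerSineProd_neg_sq, ← pi_mul_mul_eulerSineProd_neg_sq, hhalf, ← neg_div]
  linear_combination (Real.pi * z) * (Real.pi * (z / 2)) ^ 2 *
    tsum_prodRatioLimit_altInvSq_mul_eulerSineProd hz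

end EulerProduct

open PowerSeries

section Taylor

variable {𝕜 : Type*} [NontriviallyNormedField 𝕜]

/-- The Taylor series of `f` at `x` as a formal power series. -/
noncomputable def taylorPowerSeries (f : 𝕜 → 𝕜) (x : 𝕜) : PowerSeries 𝕜 :=
  PowerSeries.mk fun n => iteratedDeriv n f x / (n.factorial : 𝕜)

theorem taylorPowerSeries_congr {f g : 𝕜 → 𝕜} {x : 𝕜} (h : f =ᶠ[𝓝 x] g) :
    taylorPowerSeries f x = taylorPowerSeries g x := by
  simp only [taylorPowerSeries, h.iteratedDeriv_eq]

theorem taylorPowerSeries_const_mul (a : 𝕜) (f : 𝕜 → 𝕜) (x : 𝕜) :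
    taylorPowerSeries (fun z => a * f z) x = C a * taylorPowerSeries f x := by
  ext n
  simp only [taylorPowerSeries, coeff_C_mul, coeff_mk, iteratedDeriv_const_mul_field,
    mul_div_assoc]

theorem hasFPowerSeriesAt_of_eventually_hasSum {f : 𝕜 → 𝕜} {F : PowerSeries 𝕜}
    (h : ∀ᶠ z in 𝓝 0, HasSum (fun n => coeff n F * z ^ n) (f z)) :
    HasFPowerSeriesAt f (FormalMultilinearSeries.ofScalars 𝕜 fun n => coeff n F) 0 := by
  rw [hasFPowerSeriesAt_iff]
  simpa only [FormalMultilinearSeries.coeff_ofScalars, smul_eq_mul, mul_comm, zero_add] using h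

variable [CompleteSpace 𝕜] [CharZero 𝕜]

theorem taylorPowerSeries_mul {f g : 𝕜 → 𝕜} {x : 𝕜} (hf : AnalyticAt 𝕜 f x)
    (hg : AnalyticAt 𝕜 g x) :
    taylorPowerSeries (fun z => f z * g z) x = taylorPowerSeries f x * taylorPowerSeries g x := by
  ext n
  rw [coeff_mul, Nat.sum_antidiagonal_eq_sum_range_succ_mk]
  simp only [taylorPowerSeries, coeff_mk]
  rw [iteratedDeriv_fun_mul hf.contDiffAt hg.contDiffAt, sum_div]
  refine sum_congr rfl fun i hi => ?_
  have hfact : ∀ j : ℕ, (j.factorial : 𝕜) ≠ 0 := fun j => Nat.cast_ne_zero.2 j.factorial_ne_zero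
  rw [Nat.cast_choose 𝕜 (mem_range_succ_iff.1 hi)]
  field_simp [hfact]

theorem taylorPowerSeries_eq_of_eventually_hasSum {f : 𝕜 → 𝕜} {F : PowerSeries 𝕜}
    (h : ∀ᶠ z in 𝓝 0, HasSum (fun n => coeff n F * z ^ n) (f z)) :
    taylorPowerSeries f 0 = F := by
  have hF := hasFPowerSeriesAt_of_eventually_hasSum h
  ext n
  rw [taylorPowerSeries, coeff_mk]
  exact congrFun (FormalMultilinearSeries.ofScalars_series_injective 𝕜 𝕜
    (hF.analyticAt.hasFPowerSeriesAt.eq_formalMultilinearSeries hF)) n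

end Taylor

theorem hasSum_coeff_expand_mul_pow {R : Type*} [CommRing R] [TopologicalSpace R] {p : ℕ}
    (hp : p ≠ 0) {F : PowerSeries R} {z s : R} (h : HasSum (fun n => coeff n F * (z ^ p) ^ n) s) :
    HasSum (fun n => coeff n (expand p hp F) * z ^ n) s := by
  refine ((mul_right_injective₀ hp).hasSum_iff fun n hn => ?_).1 ?_
  · rw [coeff_expand_of_not_dvd p hp _ fun ⟨k, hk⟩ => hn ⟨k, hk.symm⟩, zero_mul]
  · simpa only [Function.comp_def, coeff_expand_mul, pow_mul] using h

theorem rescale_expand {R : Type*} [CommRing R] {p : ℕ} (hp : p ≠ 0) (c : R) (F : PowerSeries R) :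
    rescale c (expand p hp F) = expand p hp (rescale (c ^ p) F) := by
  ext n
  rw [coeff_rescale, coeff_expand, coeff_expand]
  split_ifs with hn
  · rw [coeff_rescale, ← pow_mul, Nat.mul_div_cancel' hn]
  · rw [mul_zero]

theorem rescale_C {R : Type*} [CommSemiring R] (a r : R) : rescale a (C r) = C r := by
  ext n
  rw [coeff_rescale, coeff_C]
  split_ifs with hn
  · rw [hn, pow_zero, one_mul]
  · rw [mul_zero]

section Hyperbolic

variable (K : Type*) [Field K] [Algebra ℚ K]

/-- The formal power series of the hyperbolic sine. -/
noncomputable def sinhPowerSeries : PowerSeries K :=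
  C 2⁻¹ * (exp K - rescale (-1) (exp K))

/-- The formal power series of the hyperbolic cosine. -/
noncomputable def coshPowerSeries : PowerSeries K :=
  C 2⁻¹ * (exp K + rescale (-1) (exp K))

/-- The formal power series `∑ B₂ₙ / (2n)! * X ^ n`; substituting `X ^ 2` for `X` gives the even
part of the Bernoulli generating series `X / (exp X - 1)`. -/
noncomputable def evenBernoulliPowerSeries : PowerSeries K :=
  PowerSeries.mk fun n => algebraMap ℚ K (bernoulli (2 * n) / (2 * n).factorial)

theorem two_mul_C_inv_two : (2 : PowerSeries K) * C 2⁻¹ = 1 := by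
  have : CharZero K := algebraRat.charZero K
  rw [← map_ofNat C, ← map_mul, mul_inv_cancel₀ two_ne_zero, map_one]

theorem sinhPowerSeries_ne_zero : sinhPowerSeries K ≠ 0 := fun h => by
  have : CharZero K := algebraRat.charZero K
  have h1 := congrArg (coeff 1) h
  norm_num [sinhPowerSeries, coeff_rescale, coeff_exp] at h1

theorem coshPowerSeries_ne_zero : coshPowerSeries K ≠ 0 := fun h => by
  have : CharZero K := algebraRat.charZero K
  have h0 := congrArg (coeff 0) h
  norm_num [coshPowerSeries, -coeff_zero_eq_constantCoeff, coeff_rescale] at h0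

theorem rescale_two_exp : rescale 2 (exp K) = exp K ^ 2 :=
  mod_cast (exp_pow_eq_rescale_exp (A := K) 2).symm

theorem rescale_two_rescale_neg_one_exp :
    rescale 2 (rescale (-1) (exp K)) = rescale (-1) (exp K) ^ 2 := by
  rw [← map_pow, ← rescale_two_exp, rescale_rescale, rescale_rescale, mul_comm]

theorem rescale_two_sinhPowerSeries :
    rescale 2 (sinhPowerSeries K) = 2 * sinhPowerSeries K * coshPowerSeries K := by
  simp only [sinhPowerSeries, coshPowerSeries, map_mul, map_sub, rescale_C, rescale_two_exp,
    rescale_two_rescale_neg_one_exp]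
  linear_combination (-C 2⁻¹ * (exp K ^ 2 - rescale (-1) (exp K) ^ 2)) * two_mul_C_inv_two K

theorem rescale_two_coshPowerSeries :
    rescale 2 (coshPowerSeries K) = coshPowerSeries K ^ 2 + sinhPowerSeries K ^ 2 := by
  simp only [sinhPowerSeries, coshPowerSeries, map_mul, map_add, rescale_C, rescale_two_exp,
    rescale_two_rescale_neg_one_exp]
  linear_combination (-C 2⁻¹ * (exp K ^ 2 + rescale (-1) (exp K) ^ 2)) * two_mul_C_inv_two K

theorem two_mul_expand_evenBernoulliPowerSeries :
    2 * expand 2 two_ne_zero (evenBernoulliPowerSeries K) =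
      bernoulliPowerSeries K + rescale (-1) (bernoulliPowerSeries K) := by
  ext n
  rw [map_add, coeff_rescale, ← map_ofNat C, coeff_C_mul]
  obtain ⟨k, rfl | rfl⟩ := n.even_or_odd'
  · rw [coeff_expand_mul, evenBernoulliPowerSeries, bernoulliPowerSeries, coeff_mk, coeff_mk,
      (even_two_mul k).neg_one_pow, one_mul, two_mul]
  · rw [coeff_expand_of_not_dvd 2 two_ne_zero _ k.two_not_dvd_two_mul_add_one,
      (odd_two_mul_add_one k).neg_one_pow, neg_one_mul, add_neg_cancel, mul_zero]

theorem rescale_two_expand_evenBernoulliPowerSeries_mul_sinh :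
    rescale 2 (expand 2 two_ne_zero (evenBernoulliPowerSeries K)) * sinhPowerSeries K =
      X * coshPowerSeries K := by
  have hexp : exp K * rescale (-1) (exp K) = 1 := exp_mul_exp_neg_eq_one
  have hB := congrArg (rescale 2) (bernoulliPowerSeries_mul_exp_sub_one K)
  have hB' := congrArg (rescale 2 ∘ rescale (-1)) (bernoulliPowerSeries_mul_exp_sub_one K)
  have heven := congrArg (rescale 2) (two_mul_expand_evenBernoulliPowerSeries K)
  simp only [Function.comp_apply, map_mul, map_add, map_sub, map_one, map_ofNat, rescale_two_exp,
    rescale_two_rescale_neg_one_exp, rescale_X, map_neg] at hB hB' heven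
  rw [sinhPowerSeries, coshPowerSeries]
  generalize exp K = e at *
  generalize rescale (-1) e = e' at *
  generalize rescale 2 (bernoulliPowerSeries K) = b at *
  generalize rescale 2 (rescale (-1) (bernoulliPowerSeries K)) = b' at *
  generalize rescale 2 (expand 2 two_ne_zero (evenBernoulliPowerSeries K)) = u at *
  have htwice : 2 * (u * (e - e')) = 2 * (X * (e + e')) := by
    linear_combination (e - e') * heven + e' * hB - e * hB' - (b * e - b' * e') * hexp
  linear_combination C 2⁻¹ ^ 2 * htwice -
    C 2⁻¹ * (u * (e - e') - X * (e + e')) * two_mul_C_inv_two K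

theorem rescale_two_sub_rescale_four_expand_evenBernoulliPowerSeries_mul_cosh :
    (rescale 2 (expand 2 two_ne_zero (evenBernoulliPowerSeries K)) -
        rescale 4 (expand 2 two_ne_zero (evenBernoulliPowerSeries K))) * coshPowerSeries K =
      -(X * sinhPowerSeries K) := by
  have hcoth := rescale_two_expand_evenBernoulliPowerSeries_mul_sinh K
  have hcoth2 := congrArg (rescale 2) hcoth
  rw [map_mul, map_mul, rescale_rescale, rescale_two_sinhPowerSeries, rescale_two_coshPowerSeries,
    rescale_X, map_ofNat, show (2 * 2 : K) = 4 by norm_num] at hcoth2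
  generalize rescale 2 (expand 2 two_ne_zero (evenBernoulliPowerSeries K)) = u at *
  generalize rescale 4 (expand 2 two_ne_zero (evenBernoulliPowerSeries K)) = v at *
  apply mul_right_cancel₀ (sinhPowerSeries_ne_zero K)
  linear_combination coshPowerSeries K * hcoth - C 2⁻¹ * hcoth2 +
    (v * sinhPowerSeries K * coshPowerSeries K -
      X * (coshPowerSeries K ^ 2 + sinhPowerSeries K ^ 2)) * two_mul_C_inv_two K

end Hyperbolic

section Bernoulli

theorem hasSum_coeff_rescale_sinhPowerSeries (c z : ℂ) :
    HasSum (fun n => coeff n (rescale c (sinhPowerSeries ℂ)) * z ^ n) (Complex.sinh (c * z)) := by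
  have hexp : ∀ w : ℂ, HasSum (fun n => w ^ n / (n.factorial : ℂ)) (Complex.exp w) := fun w => by
    simpa only [Complex.exp_eq_exp_ℂ] using NormedSpace.expSeries_div_hasSum_exp w
  rw [Complex.sinh, div_eq_inv_mul]
  refine (((hexp (c * z)).sub (hexp (-(c * z)))).mul_left 2⁻¹).congr_fun fun n => ?_
  rw [coeff_rescale, sinhPowerSeries, coeff_C_mul, map_sub, coeff_rescale, coeff_exp,
    neg_pow (c * z), map_div₀, map_one, map_natCast]
  ring

theorem taylorPowerSeries_sinh (c : ℂ) :
    taylorPowerSeries (fun z => Complex.sinh (c * z)) 0 = rescale c (sinhPowerSeries ℂ) :=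
  taylorPowerSeries_eq_of_eventually_hasSum <| .of_forall <|
    hasSum_coeff_rescale_sinhPowerSeries c

/-- The generating series `∑ ζ⋆(threeOneIndex m) * X ^ m`. -/
noncomputable def threeOnePowerSeries : PowerSeries ℂ :=
  PowerSeries.mk fun m => ((prodRatioLimit altInvSq m : ℝ) : ℂ)

theorem eventually_mul_norm_sq_lt_one (a : ℝ) : ∀ᶠ z : ℂ in 𝓝 0, a * ‖z ^ 2‖ < 1 := by
  have h : Tendsto (fun z : ℂ => a * ‖z ^ 2‖) (𝓝 0) (𝓝 (a * ‖(0 : ℂ) ^ 2‖)) :=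
    Continuous.tendsto (by fun_prop) 0
  exact h.eventually_lt_const (by norm_num)

theorem eventually_hasSum_expand_threeOnePowerSeries :
    ∀ᶠ z in 𝓝 0, HasSum (fun n => coeff n (expand 2 two_ne_zero threeOnePowerSeries) * z ^ n)
      (∑' m, ((prodRatioLimit altInvSq m : ℝ) : ℂ) * (z ^ 2) ^ m) := by
  filter_upwards [eventually_mul_norm_sq_lt_one (2 * ∑' l, ‖altInvSq l‖)] with z hz
  have hsum := summable_prodRatioLimit_mul_pow (b := fun l => (altInvSq l : ℂ))
    (by simpa only [Complex.norm_real] using summable_norm_altInvSq)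
    (by simpa only [Complex.norm_real] using hz)
  simp only [← ofReal_prodRatioLimit] at hsum
  refine hasSum_coeff_expand_mul_pow two_ne_zero ?_
  simpa only [threeOnePowerSeries, coeff_mk] using hsum.hasSum

theorem expand_threeOnePowerSeries_mul_sinh :
    expand 2 two_ne_zero threeOnePowerSeries * (rescale (Real.pi * Complex.I) (sinhPowerSeries ℂ) *
        (rescale (Real.pi / 2 : ℂ) (sinhPowerSeries ℂ) *
          rescale (Real.pi / 2 : ℂ) (sinhPowerSeries ℂ))) =
      C (-Complex.I) * (rescale (Real.pi : ℂ) (sinhPowerSeries ℂ) *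
        (rescale (Real.pi / 2 * Complex.I) (sinhPowerSeries ℂ) *
          rescale (Real.pi / 2 * Complex.I) (sinhPowerSeries ℂ))) := by
  have hF := eventually_hasSum_expand_threeOnePowerSeries
  have hFan := (hasFPowerSeriesAt_of_eventually_hasSum hF).analyticAt
  have hsinh : ∀ c : ℂ, AnalyticAt ℂ (fun z => Complex.sinh (c * z)) 0 := fun c => by fun_prop
  rw [← taylorPowerSeries_eq_of_eventually_hasSum hF]
  simp only [← taylorPowerSeries_sinh]
  rw [← taylorPowerSeries_mul (hsinh _) (hsinh _), ← taylorPowerSeries_mul (hsinh _) (hsinh _),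
    ← taylorPowerSeries_mul (hsinh _) ((hsinh _).fun_mul (hsinh _)),
    ← taylorPowerSeries_mul (hsinh _) ((hsinh _).fun_mul (hsinh _)),
    ← taylorPowerSeries_mul hFan ((hsinh _).fun_mul ((hsinh _).fun_mul (hsinh _))),
    ← taylorPowerSeries_const_mul]
  refine taylorPowerSeries_congr ?_
  filter_upwards [eventually_mul_norm_sq_lt_one (2 * ∑' l, ‖altInvSq l‖)] with z hz
  have h := tsum_prodRatioLimit_altInvSq_mul_sin hz
  have hfull : Complex.sinh (Real.pi * Complex.I * z) = Complex.sin (Real.pi * z) * Complex.I := by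
    rw [mul_right_comm, Complex.sinh_mul_I]
  have hhalf : Complex.sinh (Real.pi / 2 * Complex.I * z) =
      Complex.sin (Real.pi * (z / 2)) * Complex.I := by
    rw [mul_right_comm, Complex.sinh_mul_I, mul_comm_div]
  have hshift : (Real.pi / 2 * z : ℂ) = Real.pi * (z / 2) := by rw [mul_comm_div]
  rw [hfull, hhalf, hshift]
  linear_combination Complex.I * h + Complex.I * Complex.sinh (Real.pi * z) *
    Complex.sin (Real.pi * (z / 2)) ^ 2 * Complex.I_sq

theorem expand_threeOnePowerSeries_mul_cosh_mul_sinh :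
    expand 2 two_ne_zero threeOnePowerSeries *
        (rescale (Real.pi / 2 * Complex.I) (coshPowerSeries ℂ) *
          rescale (Real.pi / 2 : ℂ) (sinhPowerSeries ℂ)) =
      -C Complex.I * (rescale (Real.pi / 2 : ℂ) (coshPowerSeries ℂ) *
        rescale (Real.pi / 2 * Complex.I) (sinhPowerSeries ℂ)) := by
  have hpi : (Real.pi / 2 : ℂ) ≠ 0 := by simp [Real.pi_ne_zero]
  have hdouble := fun c : ℂ => congrArg (rescale c) (rescale_two_sinhPowerSeries ℂ)
  simp only [rescale_rescale, map_mul, map_ofNat] at hdouble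
  have hreal := hdouble (Real.pi / 2)
  have himag := hdouble (Real.pi / 2 * Complex.I)
  rw [mul_div_cancel₀ _ two_ne_zero] at hreal
  rw [← mul_assoc, mul_div_cancel₀ _ two_ne_zero] at himag
  have h := expand_threeOnePowerSeries_mul_sinh
  rw [hreal, himag, map_neg] at h
  have hne : ∀ {c : ℂ}, c ≠ 0 → rescale c (sinhPowerSeries ℂ) ≠ 0 := fun hc =>
    (map_ne_zero_iff _ (rescale_injective hc)).2 (sinhPowerSeries_ne_zero ℂ)
  have htwo : (2 : PowerSeries ℂ) ≠ 0 := left_ne_zero_of_mul_eq_one (two_mul_C_inv_two ℂ)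
  refine mul_left_cancel₀ (mul_ne_zero htwo <| mul_ne_zero (hne hpi)
    (hne (mul_ne_zero hpi Complex.I_ne_zero))) ?_
  linear_combination h

theorem rescale_expand_evenBernoulliPowerSeries_mul :
    rescale (Real.pi : ℂ) (expand 2 two_ne_zero (evenBernoulliPowerSeries ℂ)) *
        (rescale (Real.pi * Complex.I) (expand 2 two_ne_zero (evenBernoulliPowerSeries ℂ)) -
          rescale (2 * Real.pi * Complex.I)
            (expand 2 two_ne_zero (evenBernoulliPowerSeries ℂ))) =
      C (Real.pi / 2 : ℂ) ^ 2 * X ^ 2 * expand 2 two_ne_zero threeOnePowerSeries := by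
  have hpi : (Real.pi / 2 : ℂ) ≠ 0 := by simp [Real.pi_ne_zero]
  have hcoth := congrArg (rescale (Real.pi / 2 : ℂ))
    (rescale_two_expand_evenBernoulliPowerSeries_mul_sinh ℂ)
  have htanh := congrArg (rescale (Real.pi / 2 * Complex.I))
    (rescale_two_sub_rescale_four_expand_evenBernoulliPowerSeries_mul_cosh ℂ)
  simp only [map_mul, map_sub, map_neg, rescale_rescale, rescale_X] at hcoth htanh
  rw [mul_div_cancel₀ _ two_ne_zero] at hcoth
  rw [← mul_assoc, mul_div_cancel₀ _ two_ne_zero, ← mul_assoc,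
    show (4 * (Real.pi / 2) : ℂ) = 2 * Real.pi by ring] at htanh
  refine mul_right_cancel₀ (mul_ne_zero
    ((map_ne_zero_iff _ (rescale_injective (mul_ne_zero hpi Complex.I_ne_zero))).2
      (coshPowerSeries_ne_zero ℂ))
    ((map_ne_zero_iff _ (rescale_injective hpi)).2 (sinhPowerSeries_ne_zero ℂ))) ?_
  linear_combination
    rescale (Real.pi / 2 * Complex.I) (coshPowerSeries ℂ) *
        (rescale (Real.pi * Complex.I) (expand 2 two_ne_zero (evenBernoulliPowerSeries ℂ)) -
          rescale (2 * Real.pi * Complex.I)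
            (expand 2 two_ne_zero (evenBernoulliPowerSeries ℂ))) * hcoth +
      C (Real.pi / 2 : ℂ) * X * rescale (Real.pi / 2 : ℂ) (coshPowerSeries ℂ) * htanh -
      C (Real.pi / 2 : ℂ) ^ 2 * X ^ 2 * expand_threeOnePowerSeries_mul_cosh_mul_sinh

theorem rescale_evenBernoulliPowerSeries_mul :
    (rescale (-(Real.pi : ℂ) ^ 2) (evenBernoulliPowerSeries ℂ) -
        rescale (-(4 * (Real.pi : ℂ) ^ 2)) (evenBernoulliPowerSeries ℂ)) *
        rescale ((Real.pi : ℂ) ^ 2) (evenBernoulliPowerSeries ℂ) =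
      C ((Real.pi / 2 : ℂ) ^ 2) * (X * threeOnePowerSeries) := by
  have h := rescale_expand_evenBernoulliPowerSeries_mul
  simp only [rescale_expand, mul_pow, Complex.I_sq, mul_neg_one] at h
  rw [show (2 : ℂ) ^ 2 = 4 by norm_num] at h
  have hX : (X ^ 2 : PowerSeries ℂ) = expand 2 two_ne_zero X := (expand_X 2 two_ne_zero).symm
  have hC : C (Real.pi / 2 : ℂ) ^ 2 = expand 2 two_ne_zero (C ((Real.pi / 2 : ℂ) ^ 2)) := by
    rw [expand_C, map_pow]
  rw [hX, hC, ← map_sub, ← map_mul, ← map_mul, ← map_mul] at h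
  ext n
  have hn := congrArg (coeff (2 * n)) h
  rwa [coeff_expand_mul, coeff_expand_mul, mul_comm, mul_assoc] at hn

theorem coeff_rescale_sub_rescale_evenBernoulliPowerSeries {K : Type*} [Field K] [Algebra ℚ K]
    (c : K) (k : ℕ) :
    coeff (k + 1) (rescale (-c) (evenBernoulliPowerSeries K) -
        rescale (-(4 * c)) (evenBernoulliPowerSeries K)) =
      (-1) ^ k * c ^ (k + 1) * (4 ^ (k + 1) - 1) *
        algebraMap ℚ K (bernoulli (2 * k + 2) / (2 * k + 2).factorial) := by
  rw [map_sub, coeff_rescale, coeff_rescale, evenBernoulliPowerSeries, coeff_mk, mul_add_one 2 k,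
    neg_pow c, neg_pow (4 * c), mul_pow, pow_succ (-1)]
  ring

theorem prodRatioLimit_altInvSq (m : ℕ) :
    prodRatioLimit altInvSq m = 4 * Real.pi ^ (2 * m) * ∑ k ∈ range (m + 1),
      (-1 : ℝ) ^ k * (4 ^ (k + 1) - 1) *
        ((bernoulli (2 * k + 2) : ℝ) / ((2 * k + 2).factorial : ℝ)) *
        ((bernoulli (2 * m - 2 * k) : ℝ) / ((2 * m - 2 * k).factorial : ℝ)) := by
  have h := congrArg (coeff (m + 1)) rescale_evenBernoulliPowerSeries_mul
  rw [coeff_C_mul, coeff_succ_X_mul, threeOnePowerSeries, coeff_mk, coeff_mul,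
    Nat.sum_antidiagonal_succ, Nat.sum_antidiagonal_eq_sum_range_succ_mk] at h
  simp only [coeff_rescale_sub_rescale_evenBernoulliPowerSeries] at h
  simp only [map_sub, coeff_rescale, pow_zero, sub_self, zero_mul, zero_add,
    evenBernoulliPowerSeries, coeff_mk, IsScalarTower.algebraMap_apply ℚ ℝ ℂ, eq_ratCast,
    Complex.coe_algebraMap] at h
  have hpi : (Real.pi : ℂ) ^ 2 ≠ 0 := by simp [Real.pi_ne_zero]
  refine Complex.ofReal_injective (mul_left_cancel₀ hpi ?_)
  calc (Real.pi : ℂ) ^ 2 * prodRatioLimit altInvSq m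
      = 4 * ((Real.pi / 2 : ℂ) ^ 2 * prodRatioLimit altInvSq m) := by ring
    _ = _ := by
      rw [← h]
      push_cast
      rw [mul_sum, mul_sum, mul_sum]
      refine sum_congr rfl fun k hk => ?_
      have hpow : (Real.pi : ℂ) ^ (2 * m) = (Real.pi ^ 2) ^ k * (Real.pi ^ 2) ^ (m - k) := by
        rw [← pow_add, Nat.add_sub_cancel' (mem_range_succ_iff.1 hk), pow_mul]
      rw [Nat.mul_sub, hpow]
      ring

end Bernoulli

theorem theorem1 (d : ℕ) :
    (Summable (zetaStarTerm (repeatIndex [3, 1] d)) ∧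
      zetaStar (repeatIndex [3, 1] d) =
        4 * Real.pi ^ (4 * d) *
          ∑ k ∈ Finset.range (2 * d + 1),
            (-1 : ℝ) ^ k * (4 ^ (k + 1) - 1) *
              ((bernoulli (2 * k + 2) : ℝ) / ((2 * k + 2).factorial : ℝ)) *
              ((bernoulli (4 * d - 2 * k) : ℝ) / ((4 * d - 2 * k).factorial : ℝ))) ∧
    (Summable (zetaStarTerm (repeatIndex [3, 1] d ++ [2])) ∧
      zetaStar (repeatIndex [3, 1] d ++ [2]) =
        4 * Real.pi ^ (4 * d + 2) *
          ∑ k ∈ Finset.range (2 * d + 2),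
            (-1 : ℝ) ^ k * (4 ^ (k + 1) - 1) *
              ((bernoulli (2 * k + 2) : ℝ) / ((2 * k + 2).factorial : ℝ)) *
              ((bernoulli (4 * d + 2 - 2 * k) : ℝ) / ((4 * d + 2 - 2 * k).factorial : ℝ))) := by
  have heven := hasSum_zetaStarTerm_threeOneIndex (2 * d)
  have hodd := hasSum_zetaStarTerm_threeOneIndex (2 * d + 1)
  rw [prodRatioLimit_altInvSq, threeOneIndex_two_mul, show 2 * (2 * d) = 4 * d by ring] at heven
  rw [prodRatioLimit_altInvSq, threeOneIndex_two_mul_add_one,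
    show 2 * (2 * d + 1) = 4 * d + 2 by ring] at hodd
  exact ⟨⟨heven.summable, heven.tsum_eq⟩, hodd.summable, hodd.tsum_eq⟩
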